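/- **Theorem.** Let $M$ be a regular matroid on a finite ground set $E$, and let $A$ be any totally unimodular integer matrix, with columns indexed by $E$, that represents $M$ over $\mathbb{Q}$ (a subset of $E$ is independent in $M$ if and only if the corresponding columns of $A$ are linearly independent over $\mathbb{Q}$; $M$ is regular if and only if such an $A$ exists). A *signed circuit* (resp. *signed cocircuit*) of $M$ is a nonzero vector $\alpha\in\mathbb{Z}^E$ in $\ker A$ (resp. in the row space of $A$ over $\mathbb{Q}$) with all coordinates in $\{0,1,-1\}$ whose support is a circuit (resp. cocircuit) of $M$. A *signature* $\sigma$ of the circuits (resp. $\sigma^*$ of the cocircuits) of $M$ is a choice, for each circuit (resp. cocircuit) $C$, of a signed circuit (resp. signed cocircuit) with support $C$. It is *acyclic* if the only non-negative real numbers $(a_C)_C$ with $\sum_C a_C\,\sigma(C)=0$ in $\mathbb{R}^E$ (resp. $\sum_C a_C\,\sigma^*(C)=0$) are $a_C=0$ for all $C$. An *orientation* of $M$ is a function $\mathcal{O}:E\to\{1,-1\}$. It is *compatible* with a signed circuit or cocircuit $\alpha$ if $\mathcal{O}(e)=\alpha(e)$ for every $e$ in the support of $\alpha$; the corresponding *reversal*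 replaces $\mathcal{O}$ by the orientation obtained by changing the sign of $\mathcal{O}(e)$ exactly for the $e$ in the support of $\alpha$. Let $\mathcal{G}(M)$ be the set of equivalence classes $[\mathcal{O}]$ of orientations under the equivalence relation generated by all circuit and cocircuit reversals. Let $\sigma$ and $\sigma^*$ be acyclic signatures of the circuits and of the cocircuits of $M$, respectively. For a basis $B$ of $M$ and $e\notin B$, let $C(B,e)$ be the fundamental circuit, i.e. the unique circuit contained in $B\cup\{e\}$; for $e\in B$, let $C^*(B,e)$ be the fundamental cocircuit, i.e. the unique cocircuit contained in $(E\setminus B)\cup\{e\}$. Define the orientation $\mathcal{O}(B)$ by $$\mathcal{O}(B)(e)=\begin{cases}\sigma(C(B,e))(e), & e\notin B,\\ \sigma^*(C^*(B,e))(e), & e\in B.\end{cases}$$ Then the map $B\mapsto[\mathcal{O}(B)]$ is a bijection from the set of bases of $M$ to $\mathcal{G}(M)$. -/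

import Mathlib

open scoped Matrix

namespace RegularMatroid

/-- `A` is a totally unimodular integer matrix, with columns indexed by the ground set `E` of `M`,
that represents `M` over `ℚ`: a set is independent in `M` iff the corresponding columns of `A`
are linearly independent over `ℚ`. A matroid is regular iff it has such a representation. -/
structure Represents {R E : Type*} (A : Matrix R E ℤ) (M : Matroid E) : Prop where
  ground_eq : M.E = Set.univ
  totallyUnimodular : A.IsTotallyUnimodular
  indep_iff : ∀ X : Set E,
    M.Indep X ↔ LinearIndepOn ℚ (fun (e : E) (i : R) => (A i e : ℚ)) X

/-- The circuit lattice `ker A ∩ ℤ^E`. -/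
def circuitLattice {R E : Type*} [Fintype E] (A : Matrix R E ℤ) : Set (E → ℤ) :=
  {α | A *ᵥ α = 0}

/-- The cocircuit lattice: the integer vectors in the (rational) row space of `A`. -/
def cocircuitLattice {R E : Type*} [Fintype R] (A : Matrix R E ℤ) : Set (E → ℤ) :=
  {α | ∃ y : R → ℚ, y ᵥ* A.map (fun z : ℤ => (z : ℚ)) = fun e => (α e : ℚ)}

/-- The nonzero elements of `L` with all coordinates in `{0, 1, -1}` whose support belongs to the
family `𝒞`. -/
def signedSets {E : Type*} (L : Set (E → ℤ)) (𝒞 : Set (Set E)) : Set (E → ℤ) :=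
  {α | α ∈ L ∧ α ≠ 0 ∧ (∀ e, α e = 0 ∨ α e = 1 ∨ α e = -1) ∧ Function.support α ∈ 𝒞}

/-- The (unsigned) circuits of `M`. -/
def circuits {E : Type*} (M : Matroid E) : Set (Set E) := {C | M.IsCircuit C}

/-- The (unsigned) cocircuits of `M`. -/
def cocircuits {E : Type*} (M : Matroid E) : Set (Set E) := {C | M.IsCocircuit C}

/-- The signed circuits of `M` with respect to the representation `A`. -/
def signedCircuits {R E : Type*} [Fintype E] (A : Matrix R E ℤ) (M : Matroid E) :
    Set (E → ℤ) :=
  signedSets (circuitLattice A) (circuits M)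

/-- The signed cocircuits of `M` with respect to the representation `A`. -/
def signedCocircuits {R E : Type*} [Fintype R] (A : Matrix R E ℤ) (M : Matroid E) :
    Set (E → ℤ) :=
  signedSets (cocircuitLattice A) (cocircuits M)

/-- A signature: a section, over the family `𝒞`, of the map that sends a signed set to its
support. -/
structure Signature {E : Type*} (L : Set (E → ℤ)) (𝒞 : Set (Set E)) where
  toFun : 𝒞 → E → ℤ
  mem_signedSets : ∀ C : 𝒞, toFun C ∈ signedSets L 𝒞
  support_eq : ∀ C : 𝒞, Function.support (toFun C) = (C : Set E)

/-- A signature of the circuits of `M`. -/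
abbrev CircuitSignature {R E : Type*} [Fintype E] (A : Matrix R E ℤ) (M : Matroid E) :=
  Signature (circuitLattice A) (circuits M)

/-- A signature of the cocircuits of `M`. -/
abbrev CocircuitSignature {R E : Type*} [Fintype R] (A : Matrix R E ℤ) (M : Matroid E) :=
  Signature (cocircuitLattice A) (cocircuits M)

open scoped Classical in
/-- A signature `σ` is acyclic if the only nonnegative real solution of `∑ a_C σ(C) = 0` is the
trivial one. -/
def Signature.IsAcyclic {E : Type*} [Fintype E] {L : Set (E → ℤ)} {𝒞 : Set (Set E)}
    (σ : Signature L 𝒞) : Prop :=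
  ∀ a : 𝒞 → ℝ, (∀ C, 0 ≤ a C) →
    (∀ e : E, ∑ C : 𝒞, a C * (σ.toFun C e : ℝ) = 0) → ∀ C, a C = 0

theorem Signature.isUnit_apply {E : Type*} {L : Set (E → ℤ)} {𝒞 : Set (Set E)}
    (σ : Signature L 𝒞) (C : 𝒞) {e : E} (he : e ∈ (C : Set E)) : IsUnit (σ.toFun C e) := by
  rw [← σ.support_eq C, Function.mem_support] at he
  rw [Int.isUnit_iff]
  exact ((σ.mem_signedSets C).2.2.1 e).resolve_left he

/-- An orientation is a map from the ground set to `{1, -1} = ℤˣ`. -/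
abbrev Orientation (E : Type*) := E → ℤˣ

/-- The orientation `O` agrees with the signed set `α` on the support of `α`. -/
def Compatible {E : Type*} (O : Orientation E) (α : E → ℤ) : Prop :=
  ∀ e ∈ Function.support α, (O e : ℤ) = α e

/-- Reverse the orientation of exactly the elements of the support of `α`. -/
def reverse {E : Type*} (O : Orientation E) (α : E → ℤ) : Orientation E :=
  fun e => if α e = 0 then O e else -O e

/-- `O'` arises from `O` by one circuit reversal or one cocircuit reversal. -/
def Reversal {R E : Type*} [Fintype R] [Fintype E] (A : Matrix R E ℤ) (M : Matroid E)
    (O O' : Orientation E) : Prop :=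
  ∃ α ∈ signedCircuits A M ∪ signedCocircuits A M, Compatible O α ∧ O' = reverse O α

/-- The equivalence relation generated by circuit and cocircuit reversals. -/
def reversalSetoid {R E : Type*} [Fintype R] [Fintype E] (A : Matrix R E ℤ) (M : Matroid E) :
    Setoid (Orientation E) :=
  Relation.EqvGen.setoid (Reversal A M)

/-- The set `𝒢(M)` of circuit-cocircuit reversal classes of orientations. -/
abbrev ReversalClasses {R E : Type*} [Fintype R] [Fintype E] (A : Matrix R E ℤ)
    (M : Matroid E) :=
  Quotient (reversalSetoid A M)

theorem fundCircuit_mem_circuits {R E : Type*} {A : Matrix R E ℤ} {M : Matroid E}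
    (hA : Represents A M) {B : Set E} (hB : M.IsBase B) {e : E} (he : e ∉ B) :
    M.fundCircuit e B ∈ circuits M :=
  hB.fundCircuit_isCircuit (hA.ground_eq ▸ Set.mem_univ e) he

theorem fundCocircuit_mem_cocircuits {E : Type*} {M : Matroid E}
    {B : Set E} (hB : M.IsBase B) {e : E} (he : e ∈ B) :
    M.fundCocircuit e B ∈ cocircuits M :=
  Matroid.fundCocircuit_isCocircuit he hB

open scoped Classical in
/-- The orientation `O(B)` of a basis `B`: an element `e ∈ B` gets its sign in `σ*(C*(B, e))`,
where `C*(B, e)` is the fundamental cocircuit, and an element `e ∉ B` gets its sign in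
`σ(C(B, e))`, where `C(B, e)` is the fundamental circuit. -/
noncomputable def basisOrientation {R E : Type*} [Fintype R] [Fintype E] {A : Matrix R E ℤ}
    {M : Matroid E} (hA : Represents A M) (σ : CircuitSignature A M)
    (σ' : CocircuitSignature A M) (B : {B : Set E // M.IsBase B}) : Orientation E :=
  fun e =>
    if he : e ∈ (B : Set E) then
      (σ'.isUnit_apply ⟨M.fundCocircuit e B, fundCocircuit_mem_cocircuits B.2 he⟩
        (M.mem_fundCocircuit e B)).unit
    else
      (σ.isUnit_apply ⟨M.fundCircuit e B, fundCircuit_mem_circuits hA B.2 he⟩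
        (M.mem_fundCircuit e B)).unit

end RegularMatroid

/-! Let `V` be the real kernel of `A` and `W` its real row space. They are orthogonal and contain
the signed circuits and the signed cocircuits respectively, and acyclicity makes the cone of each
signature pointed. The plan is to show that every reversal class contains exactly one orientation
that respects both signatures, and that these orientations are exactly the `O(B)`, each coming from
one base.

Existence: some `w` is positive on both signatures, and reversing a wrongly signed set increases the
pairing of the orientation with `w`, so a maximiser in the class respects both (`exists_respects`).
Uniqueness: if `O` and `O'` are equivalent, then `O - O' = x + y` with `x ∈ V`, `y ∈ W`, both
conformal to `O`, and their negatives conformal to `O'` (`SplitEquiv.exists_conformal`). When both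
orientations respect the signatures, `x`, `-x` and `y`, `-y` lie in the cones, so `x = y = 0`
(`SplitEquiv.eq`).

Bases: expansion in fundamental circuits shows that `O(B)` respects both signatures. The base is
recovered as the support of the vector of `w + V` vanishing off `B` (`base_eq_of_matches`).
Conversely, for a respecting `O`, a linear program over a translate of `V` cut by the orthant of `O`
has an optimum whose support is a base; positivity on cocircuits gives the signs on the base,
optimality the signs off it (`exists_base_of_respects`). -/

namespace RegularMatroid

/-! ### Cones of acyclic signatures and conformal reduction -/

section SignatureCones

variable {E : Type*}

/-- **Gordan's theorem**: finitely many vectors with no nontrivial nonnegative relation lie in an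
open half-space. -/
theorem exists_forall_dotProduct_pos [Fintype E] {ι : Type*} [Fintype ι] (v : ι → E → ℝ)
    (hv : ∀ a : ι → ℝ, (∀ i, 0 ≤ a i) → ∑ i, a i • v i = 0 → ∀ i, a i = 0) :
    ∃ w : E → ℝ, ∀ i, 0 < w ⬝ᵥ v i := by
  classical
  -- `K` is the convex hull of the vectors. Its coefficients sum to 1, so the hypothesis excludes 0,
  -- and compactness gives strict separation.
  set K : Set (E → ℝ) := Fintype.linearCombination ℝ v '' stdSimplex ℝ ι with hK
  have hconv : Convex ℝ K := (convex_stdSimplex ℝ ι).linear_image _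
  have hcomp : IsCompact K :=
    (isCompact_stdSimplex ℝ ι).image (LinearMap.continuous_of_finiteDimensional _)
  have h0 : (0 : E → ℝ) ∉ K := by
    rintro ⟨a, ha, hsum⟩
    have h := hv a ha.1 (by simpa [Fintype.linearCombination_apply] using hsum)
    have := ha.2
    simp [h] at this
  obtain ⟨f, u, hf0, hf⟩ := geometric_hahn_banach_point_closed hconv hcomp.isClosed h0
  refine ⟨fun e => f (Pi.single e 1), fun i => ?_⟩
  have hi : v i ∈ K := ⟨Pi.single i 1, single_mem_stdSimplex ℝ i, by simp⟩
  have h1 := hf _ hi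
  rw [map_zero] at hf0
  have h2 : f (v i) = (fun e => f (Pi.single e 1)) ⬝ᵥ v i := by
    conv_lhs => rw [← Finset.univ_sum_single (v i)]
    rw [map_sum]
    refine Finset.sum_congr rfl fun e _ => ?_
    have : (Pi.single e (v i e) : E → ℝ) = v i e • Pi.single e 1 := by
      rw [← Pi.single_smul]; simp
    rw [this, map_smul, smul_eq_mul, mul_comm]
  linarith

/-- An integer vector, viewed as a real vector. -/
def toReal (α : E → ℤ) : E → ℝ := fun e => (α e : ℝ)

@[simp] theorem toReal_apply (α : E → ℤ) (e : E) : toReal α e = (α e : ℝ) := rfl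

/-- `z` lies in the closed orthant of the orientation `O`. -/
def Conformal (O : Orientation E) (z : E → ℝ) : Prop := ∀ e, 0 ≤ z e * ((O e : ℤ) : ℝ)

theorem cast_unit_eq (O : Orientation E) (e : E) :
    ((O e : ℤ) : ℝ) = 1 ∨ ((O e : ℤ) : ℝ) = -1 := by
  rcases Int.units_eq_one_or (O e) with h | h <;> simp [h]

theorem cast_unit_mul_self (O : Orientation E) (e : E) :
    ((O e : ℤ) : ℝ) * ((O e : ℤ) : ℝ) = 1 := by
  rcases cast_unit_eq O e with h | h <;> simp [h]

theorem Compatible.conformal {O : Orientation E} {α : E → ℤ} (h : Compatible O α) :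
    Conformal O (toReal α) := by
  intro e
  by_cases he : α e = 0
  · simp [he]
  · rw [toReal_apply, ← h e he, cast_unit_mul_self]
    exact zero_le_one

namespace Signature

variable {L : Set (E → ℤ)} {𝒞 : Set (Set E)}

theorem toFun_eq (σ : Signature L 𝒞) (C : 𝒞) (e : E) :
    σ.toFun C e = 0 ∨ σ.toFun C e = 1 ∨ σ.toFun C e = -1 :=
  (σ.mem_signedSets C).2.2.1 e

theorem toFun_ne_zero_iff (σ : Signature L 𝒞) (C : 𝒞) (e : E) :
    σ.toFun C e ≠ 0 ↔ e ∈ (C : Set E) := by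
  rw [← σ.support_eq C, Function.mem_support]

/-- The convex cone generated by the signed sets of a signature. -/
noncomputable def cone (σ : Signature L 𝒞) : Submodule NNReal (E → ℝ) :=
  Submodule.span NNReal (Set.range fun C => toReal (σ.toFun C))

theorem toReal_mem_cone (σ : Signature L 𝒞) (C : 𝒞) : toReal (σ.toFun C) ∈ σ.cone :=
  Submodule.subset_span ⟨C, rfl⟩

theorem smul_mem_cone (σ : Signature L 𝒞) {t : ℝ} (ht : 0 ≤ t) {z : E → ℝ} (hz : z ∈ σ.cone) :
    t • z ∈ σ.cone :=
  σ.cone.smul_mem ⟨t, ht⟩ hz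

theorem toReal_toFun_ne_zero (σ : Signature L 𝒞) (C : 𝒞) : toReal (σ.toFun C) ≠ 0 := by
  intro h
  refine (σ.mem_signedSets C).2.1 (funext fun e => ?_)
  have := congrFun h e
  simpa using this

/-- No signed set compatible with `O` is opposite to one in the signature. -/
def Respects (σ : Signature L 𝒞) (O : Orientation E) : Prop :=
  ∀ C, ¬ Compatible O (-σ.toFun C)

theorem Respects.exists_eq {σ : Signature L 𝒞} {O : Orientation E} (h : σ.Respects O) (C : 𝒞) :
    ∃ e ∈ (C : Set E), σ.toFun C e = (O e : ℤ) := by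
  have := h C
  simp only [Compatible, Function.mem_support, not_forall] at this
  obtain ⟨e, he, hne⟩ := this
  have he' : σ.toFun C e ≠ 0 := by simpa using he
  refine ⟨e, (σ.toFun_ne_zero_iff C e).1 he', ?_⟩
  rcases σ.toFun_eq C e with h1 | h1 | h1
  · exact absurd h1 he'
  · rcases Int.units_eq_one_or (O e) with h2 | h2 <;> simp_all
  · rcases Int.units_eq_one_or (O e) with h2 | h2 <;> simp_all

variable [Fintype E]

open scoped Classical in
theorem mem_cone_iff (σ : Signature L 𝒞) {z : E → ℝ} :
    z ∈ σ.cone ↔ ∃ a : 𝒞 → ℝ, (∀ C, 0 ≤ a C) ∧ ∑ C, a C • toReal (σ.toFun C) = z := by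
  rw [cone, Submodule.mem_span_range_iff_exists_fun]
  constructor
  · rintro ⟨c, hc⟩
    exact ⟨fun C => c C, fun C => (c C).2, hc⟩
  · rintro ⟨a, ha, h⟩
    exact ⟨fun C => ⟨a C, ha C⟩, h⟩

theorem cone_le_restrictScalars (σ : Signature L 𝒞) {V : Submodule ℝ (E → ℝ)}
    (hL : ∀ α ∈ L, toReal α ∈ V) {z : E → ℝ} (hz : z ∈ σ.cone) : z ∈ V := by
  classical
  obtain ⟨a, -, rfl⟩ := σ.mem_cone_iff.1 hz
  exact V.sum_mem fun C _ => V.smul_mem _ (hL _ (σ.mem_signedSets C).1)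

theorem dotProduct_nonneg_of_mem_cone (σ : Signature L 𝒞) {w : E → ℝ}
    (hw : ∀ C, 0 < w ⬝ᵥ toReal (σ.toFun C)) {z : E → ℝ} (hz : z ∈ σ.cone) : 0 ≤ w ⬝ᵥ z := by
  classical
  obtain ⟨a, ha, rfl⟩ := σ.mem_cone_iff.1 hz
  rw [dotProduct_sum]
  refine Finset.sum_nonneg fun C _ => ?_
  rw [dotProduct_smul]
  exact mul_nonneg (ha C) (hw C).le

open scoped Classical in
theorem IsAcyclic.eq_zero_of_sum {σ : Signature L 𝒞} (hσ : σ.IsAcyclic) {a : 𝒞 → ℝ}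
    (ha : ∀ C, 0 ≤ a C) (h : ∑ C, a C • toReal (σ.toFun C) = 0) (C : 𝒞) : a C = 0 := by
  refine hσ a ha (fun e => ?_) C
  have := congrFun h e
  simpa [Finset.sum_apply] using this

theorem IsAcyclic.cone_pointed {σ : Signature L 𝒞} (hσ : σ.IsAcyclic) {z : E → ℝ}
    (hz : z ∈ σ.cone) (hz' : -z ∈ σ.cone) : z = 0 := by
  classical
  obtain ⟨a, ha, hza⟩ := σ.mem_cone_iff.1 hz
  obtain ⟨b, hb, hzb⟩ := σ.mem_cone_iff.1 hz'
  have h : ∀ C, a C + b C = 0 := by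
    refine hσ.eq_zero_of_sum (a := fun C => a C + b C) (fun C => add_nonneg (ha C) (hb C)) ?_
    simp only [add_smul, Finset.sum_add_distrib]
    rw [hza, hzb, add_neg_cancel]
  rw [← hza]
  refine Finset.sum_eq_zero fun C _ => ?_
  have : a C = 0 := by linarith [h C, ha C, hb C]
  rw [this, zero_smul]

theorem IsAcyclic.neg_notMem_cone {σ : Signature L 𝒞} (hσ : σ.IsAcyclic) (C : 𝒞) :
    -toReal (σ.toFun C) ∉ σ.cone := fun h =>
  σ.toReal_toFun_ne_zero C (hσ.cone_pointed (σ.toReal_mem_cone C) h)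

/-- Subtracting a suitable multiple of a signed set keeps a vector in its orthant and shrinks its
support. -/
theorem Respects.exists_sub_smul {σ : Signature L 𝒞} {O : Orientation E} (h : σ.Respects O)
    (C : 𝒞) {d : E → ℝ} (hd : Conformal O d) (hC : (C : Set E) ⊆ Function.support d) :
    ∃ t : ℝ, 0 < t ∧ Conformal O (d - t • toReal (σ.toFun C)) ∧
      Function.support (d - t • toReal (σ.toFun C)) ⊂ Function.support d := by
  classical
  obtain ⟨e₁, he₁C, he₁⟩ := h.exists_eq C
  -- Only coordinates where the signed set agrees with `O` move towards zero. The step length is the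
  -- least `|d e|` among them, so `e₀` is the first to vanish; `Respects` guarantees that there is
  -- one.
  obtain ⟨e₀, he₀, hmin⟩ := Finset.exists_min_image
    (Finset.univ.filter fun e => σ.toFun C e = (O e : ℤ)) (fun e => d e * ((O e : ℤ) : ℝ))
    ⟨e₁, by simp [he₁]⟩
  simp only [Finset.mem_filter, Finset.mem_univ, true_and] at he₀ hmin
  have he₀C : e₀ ∈ (C : Set E) := by
    rw [← σ.toFun_ne_zero_iff, he₀]
    exact (O e₀).ne_zero
  have hd₀ : d e₀ ≠ 0 := hC he₀C
  refine ⟨d e₀ * ((O e₀ : ℤ) : ℝ), ?_, ?_, ?_⟩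
  · refine lt_of_le_of_ne (hd e₀) (Ne.symm (mul_ne_zero hd₀ ?_))
    rcases cast_unit_eq O e₀ with h | h <;> simp [h]
  · intro e
    have hde := hd e
    have hd0 := hd e₀
    have hm := hmin e
    simp only [Pi.sub_apply, Pi.smul_apply, smul_eq_mul, toReal_apply]
    rcases σ.toFun_eq C e with h1 | h1 | h1 <;>
      rcases Int.units_eq_one_or (O e) with h2 | h2 <;> simp [h1, h2] at hde hm ⊢ <;> linarith
  · rw [Set.ssubset_iff_of_subset]
    · refine ⟨e₀, hd₀, ?_⟩
      simp only [Function.mem_support, Pi.sub_apply, Pi.smul_apply, smul_eq_mul, toReal_apply, he₀,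
        not_not, mul_assoc, cast_unit_mul_self]
      ring
    · intro e he hde
      have : σ.toFun C e = 0 := by
        by_contra hne
        exact hC ((σ.toFun_ne_zero_iff C e).1 hne) hde
      exact he (by simp [this, hde])

end Signature

section OneMatroid

variable [Fintype E] {N : Matroid E} {L : Set (E → ℤ)} {σ : Signature L (circuits N)} {O : Orientation E}
  {V : Submodule ℝ (E → ℝ)}

/-- Modulo the cone of the signature, a conformal vector can be given independent support. -/
theorem Signature.Respects.exists_indep_support (hN : N.E = Set.univ) (h : σ.Respects O)
    (d : E → ℝ) (hd : Conformal O d) :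
    ∃ d', Conformal O d' ∧ N.Indep (Function.support d') ∧ d - d' ∈ σ.cone := by
  induction hn : (Function.support d).ncard using Nat.strong_induction_on generalizing d with
  | _ n ih =>
    by_cases hI : N.Indep (Function.support d)
    · exact ⟨d, hd, hI, by simp⟩
    · have hdep : N.Dep (Function.support d) := ⟨hI, hN ▸ Set.subset_univ _⟩
      obtain ⟨C, hCd, hC⟩ := hdep.exists_isCircuit_subset
      obtain ⟨t, ht, hconf, hss⟩ := h.exists_sub_smul ⟨C, hC⟩ hd hCd
      obtain ⟨d', h1, h2, h3⟩ := ih _ (hn ▸ Set.ncard_lt_ncard hss (Set.toFinite _)) _ hconf rfl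
      refine ⟨d', h1, h2, ?_⟩
      have := σ.cone.add_mem h3 (σ.smul_mem_cone ht.le (σ.toReal_mem_cone ⟨C, hC⟩))
      convert this using 1
      abel

/-- Reduction to independent support stays inside `V`, where the only such vector is 0; hence all of
`z` was subtracted as cone elements. -/
theorem Signature.Respects.mem_cone (hN : N.E = Set.univ) (h : σ.Respects O)
    (hL : ∀ α ∈ L, toReal α ∈ V) (hV : ∀ z ∈ V, N.Indep (Function.support z) → z = 0)
    {z : E → ℝ} (hz : z ∈ V) (hO : Conformal O z) : z ∈ σ.cone := by
  obtain ⟨d, -, hdI, hd⟩ := h.exists_indep_support hN z hO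
  have hdV : d ∈ V := by
    have := V.sub_mem hz (σ.cone_le_restrictScalars hL hd)
    simpa using this
  rw [hV d hdV hdI, sub_zero] at hd
  exact hd

/-- Outside the base `B`, the orientation `O` agrees with the signed fundamental circuits. -/
def MatchesFundCircuits (σ : Signature L (circuits N)) (B : Set E) (O : Orientation E) : Prop :=
  ∀ e ∉ B, ∃ C : circuits N, (C : Set E) ⊆ insert e B ∧ σ.toFun C e = (O e : ℤ)

/-- Every vector of `V` expands in the signed fundamental circuits of a base. -/
theorem MatchesFundCircuits.exists_cone_sub {B : Set E} (h : MatchesFundCircuits σ B O)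
    (hL : ∀ α ∈ L, toReal α ∈ V) (z : E → ℝ) :
    ∃ u, z - u ∈ V ∧ (∀ e ∉ B, u e = 0) ∧
      ((∀ e ∉ B, 0 ≤ z e * ((O e : ℤ) : ℝ)) → z - u ∈ σ.cone) := by
  classical
  choose C hC hσ using fun e : {e // e ∉ B} => h e e.2
  -- Off `B`, the circuit `C e` is nonzero only at `e`, with sign `O e`; these coefficients
  -- therefore make `s` agree with `z` off `B`.
  set s : E → ℝ := ∑ e : {e // e ∉ B}, (z e * ((O e : ℤ) : ℝ)) • toReal (σ.toFun (C e)) with hs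
  refine ⟨z - s, ?_, fun f hf => ?_, fun hz => ?_⟩
  · rw [sub_sub_cancel]
    exact V.sum_mem fun e _ => V.smul_mem _ (hL _ (σ.mem_signedSets _).1)
  · rw [Pi.sub_apply, sub_eq_zero, hs, Finset.sum_apply, Finset.sum_eq_single ⟨f, hf⟩]
    · rw [Pi.smul_apply, smul_eq_mul, toReal_apply, hσ ⟨f, hf⟩, mul_assoc, cast_unit_mul_self,
        mul_one]
    · intro e _ hef
      have : σ.toFun (C e) f = 0 := by
        by_contra hne
        rcases hC e ((σ.toFun_ne_zero_iff _ _).1 hne) with h1 | h1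
        · exact hef (Subtype.ext h1.symm)
        · exact hf h1
      simp [this]
    · exact fun h => absurd (Finset.mem_univ _) h
  · rw [sub_sub_cancel]
    exact σ.cone.sum_mem fun e _ => σ.smul_mem_cone (hz e e.2) (σ.toReal_mem_cone _)

theorem MatchesFundCircuits.mem_cone {B : Set E} (h : MatchesFundCircuits σ B O)
    (hB : N.Indep B) (hL : ∀ α ∈ L, toReal α ∈ V)
    (hV : ∀ z ∈ V, N.Indep (Function.support z) → z = 0) {z : E → ℝ} (hz : z ∈ V)
    (hO : ∀ e ∉ B, 0 ≤ z e * ((O e : ℤ) : ℝ)) : z ∈ σ.cone := by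
  obtain ⟨u, hu, hu0, hcone⟩ := h.exists_cone_sub hL z
  have huV : u ∈ V := by simpa using V.sub_mem hz hu
  have : u = 0 := hV u huV (hB.subset fun e he => by_contra fun hne => he (hu0 e hne))
  have := hcone hO
  simp_all

theorem MatchesFundCircuits.respects {B : Set E} (h : MatchesFundCircuits σ B O)
    (hσ : σ.IsAcyclic) (hB : N.Indep B) (hL : ∀ α ∈ L, toReal α ∈ V)
    (hV : ∀ z ∈ V, N.Indep (Function.support z) → z = 0) : σ.Respects O := by
  intro C hC
  have hneg : toReal (-σ.toFun C) = -toReal (σ.toFun C) := by ext e; simp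
  refine hσ.neg_notMem_cone C (h.mem_cone hB hL hV ?_ fun e _ => ?_)
  · exact V.neg_mem (hL _ (σ.mem_signedSets C).1)
  · rw [← hneg]
    exact hC.conformal e

end OneMatroid

end SignatureCones

section DualPairs

variable {E : Type*}

/-! ### An invariant of reversal classes -/

section Reversal

variable {V W : Submodule ℝ (E → ℝ)} {O O' : Orientation E} {α : E → ℤ}

theorem reverse_of_eq_zero {e : E} (he : α e = 0) : reverse O α e = O e := by
  simp [reverse, he]

theorem reverse_of_ne_zero {e : E} (he : α e ≠ 0) : reverse O α e = -O e := by
  simp [reverse, he]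

theorem Compatible.sub_reverse (h : Compatible O α) (e : E) :
    ((O e : ℤ) : ℝ) - ((reverse O α e : ℤ) : ℝ) = 2 * (α e : ℝ) := by
  by_cases he : α e = 0
  · simp [reverse, he]
  · have := h e he
    rw [reverse_of_ne_zero he, ← this]
    push_cast
    ring

theorem Compatible.neg_reverse (h : Compatible O α) : Compatible (reverse O α) (-α) := by
  intro e he
  have he' : α e ≠ 0 := by simpa using he
  simp [reverse, he', h e he']

theorem reverse_reverse_neg (O : Orientation E) (α : E → ℤ) :
    reverse (reverse O α) (-α) = O := by
  ext e
  by_cases he : α e = 0 <;> simp [reverse, he]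

/-- The elements on which some vector of `V` in the orthant of `O` does not vanish. -/
def positivePart (V : Submodule ℝ (E → ℝ)) (O : Orientation E) : Set E :=
  {e | ∃ z ∈ V, Conformal O z ∧ z e ≠ 0}

/-- The relation preserved by reversals: the positive parts agree and the difference of the two
orientations splits along them. -/
structure SplitEquiv (V W : Submodule ℝ (E → ℝ)) (O O' : Orientation E) : Prop where
  left_eq : positivePart V O = positivePart V O'
  right_eq : positivePart W O = positivePart W O'
  exists_split : ∃ x ∈ V, ∃ y ∈ W, (∀ e, x e ≠ 0 → e ∈ positivePart V O) ∧
    (∀ e, y e ≠ 0 → e ∈ positivePart W O) ∧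
    ∀ e, ((O e : ℤ) : ℝ) - ((O' e : ℤ) : ℝ) = x e + y e

theorem SplitEquiv.refl (O : Orientation E) : SplitEquiv V W O O :=
  ⟨rfl, rfl, 0, V.zero_mem, 0, W.zero_mem, by simp, by simp, by simp⟩

theorem SplitEquiv.symm (h : SplitEquiv V W O O') : SplitEquiv V W O' O := by
  obtain ⟨h1, h2, x, hx, y, hy, hxe, hye, hxy⟩ := h
  refine ⟨h1.symm, h2.symm, -x, V.neg_mem hx, -y, W.neg_mem hy, fun e he => h1 ▸ hxe e ?_,
    fun e he => h2 ▸ hye e ?_, fun e => ?_⟩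
  · simpa using he
  · simpa using he
  · have := hxy e
    simp only [Pi.neg_apply]
    linarith

theorem SplitEquiv.trans {O'' : Orientation E} (h : SplitEquiv V W O O')
    (h' : SplitEquiv V W O' O'') : SplitEquiv V W O O'' := by
  obtain ⟨h1, h2, x, hx, y, hy, hxe, hye, hxy⟩ := h
  obtain ⟨h1', h2', x', hx', y', hy', hxe', hye', hxy'⟩ := h'
  refine ⟨h1.trans h1', h2.trans h2', x + x', V.add_mem hx hx', y + y', W.add_mem hy hy',
    fun e he => ?_, fun e he => ?_, fun e => ?_⟩
  · by_cases h0 : x e = 0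
    · exact h1 ▸ hxe' e (by simpa [h0] using he)
    · exact hxe e h0
  · by_cases h0 : y e = 0
    · exact h2 ▸ hye' e (by simpa [h0] using he)
    · exact hye e h0
  · have := hxy e
    have := hxy' e
    simp only [Pi.add_apply]
    linarith

theorem SplitEquiv.swap (h : SplitEquiv V W O O') : SplitEquiv W V O O' := by
  obtain ⟨h1, h2, x, hx, y, hy, hxe, hye, hxy⟩ := h
  exact ⟨h2, h1, y, hy, x, hx, hye, hxe, fun e => (hxy e).trans (add_comm _ _)⟩

variable [Fintype E]

theorem Conformal.mul_eq_zero {x y : E → ℝ} (hx : Conformal O x) (hy : Conformal O y)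
    (h : x ⬝ᵥ y = 0) (e : E) : x e * y e = 0 := by
  have hnn : ∀ f ∈ Finset.univ, 0 ≤ x f * y f := by
    intro f _
    have := mul_nonneg (hx f) (hy f)
    rwa [mul_mul_mul_comm, cast_unit_mul_self, mul_one] at this
  exact (Finset.sum_eq_zero_iff_of_nonneg hnn).1 h e (Finset.mem_univ e)

/-- Orthogonal vectors in a common orthant have disjoint supports, since every term of their pairing
is nonnegative. -/
theorem notMem_positivePart (horth : ∀ x ∈ V, ∀ y ∈ W, x ⬝ᵥ y = 0) {e : E}
    (he : e ∈ positivePart V O) : e ∉ positivePart W O := by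
  obtain ⟨x, hx, hxO, hxe⟩ := he
  rintro ⟨y, hy, hyO, hye⟩
  exact mul_ne_zero hxe hye (hxO.mul_eq_zero hyO (horth x hx y hy) e)

theorem Compatible.positivePart_subset (h : Compatible O α) (hα : toReal α ∈ V) :
    positivePart V O ⊆ positivePart V (reverse O α) := by
  rintro e ⟨z, hz, hzO, hze⟩
  -- `c` exceeds every `|z f|`, so `z - c • α` has the reversed sign throughout the support of `α`
  -- and is unchanged elsewhere.
  set c : ℝ := 1 + ∑ f, |z f| with hc
  have hcz : ∀ f, |z f| < c := fun f => by
    have := Finset.single_le_sum (f := fun f => |z f|) (fun f _ => abs_nonneg (z f))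
      (Finset.mem_univ f)
    linarith
  have key : ∀ f, α f ≠ 0 →
      0 < (z - c • toReal α) f * ((reverse O α f : ℤ) : ℝ) := by
    intro f hf
    have h1 := h f hf
    have h2 := hcz f
    rw [abs_lt] at h2
    simp only [reverse_of_ne_zero hf, Pi.sub_apply, Pi.smul_apply, smul_eq_mul,
      toReal_apply, ← h1]
    rcases Int.units_eq_one_or (O f) with h3 | h3 <;> simp [h3] <;> linarith
  refine ⟨z - c • toReal α, V.sub_mem hz (V.smul_mem _ hα), fun f => ?_, ?_⟩
  · by_cases hf : α f = 0
    · simpa [hf, reverse_of_eq_zero hf] using hzO f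
    · exact (key f hf).le
  · by_cases hf : α e = 0
    · simpa [hf] using hze
    · exact left_ne_zero_of_mul (key e hf).ne'

theorem Compatible.positivePart_orth_subset (horth : ∀ x ∈ V, ∀ y ∈ W, x ⬝ᵥ y = 0)
    (h : Compatible O α) (hα : toReal α ∈ V) :
    positivePart W O ⊆ positivePart W (reverse O α) := by
  rintro e ⟨z, hz, hzO, hze⟩
  refine ⟨z, hz, fun f => ?_, hze⟩
  by_cases hf : α f = 0
  · simpa [reverse_of_eq_zero hf] using hzO f
  · have := h.conformal.mul_eq_zero hzO (horth _ hα z hz) f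
    have : z f = 0 := by simpa [hf] using this
    simp [this]

theorem Compatible.splitEquiv (horth : ∀ x ∈ V, ∀ y ∈ W, x ⬝ᵥ y = 0) (h : Compatible O α)
    (hα : toReal α ∈ V) : SplitEquiv V W O (reverse O α) := by
  have hneg : toReal (-α) ∈ V := by
    have : toReal (-α) = -toReal α := by ext e; simp
    exact this ▸ V.neg_mem hα
  refine ⟨(h.positivePart_subset hα).antisymm ?_,
    (h.positivePart_orth_subset horth hα).antisymm ?_, (2 : ℝ) • toReal α, V.smul_mem _ hα, 0,
    W.zero_mem, fun e he => ⟨_, hα, h.conformal, ?_⟩, by simp, fun e => ?_⟩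
  · simpa [reverse_reverse_neg] using h.neg_reverse.positivePart_subset hneg
  · simpa [reverse_reverse_neg] using h.neg_reverse.positivePart_orth_subset horth hneg
  · simpa using he
  · simp [h.sub_reverse e]

/-- The positive parts are disjoint, so at each element one of `x`, `y` vanishes and the other
equals `O - O'`, which is zero or has the sign of `O` and the opposite sign to `O'`. -/
theorem SplitEquiv.exists_conformal (horth : ∀ x ∈ V, ∀ y ∈ W, x ⬝ᵥ y = 0)
    (h : SplitEquiv V W O O') : ∃ x ∈ V, ∃ y ∈ W, Conformal O x ∧ Conformal O' (-x) ∧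
      Conformal O y ∧ Conformal O' (-y) ∧
      ∀ e, ((O e : ℤ) : ℝ) - ((O' e : ℤ) : ℝ) = x e + y e := by
  obtain ⟨-, -, x, hx, y, hy, hxe, hye, hxy⟩ := h
  have key : ∀ e, (x e = 0 ∨ x e = ((O e : ℤ) : ℝ) - ((O' e : ℤ) : ℝ)) ∧
      (y e = 0 ∨ y e = ((O e : ℤ) : ℝ) - ((O' e : ℤ) : ℝ)) := by
    intro e
    have := hxy e
    by_cases h1 : x e = 0
    · refine ⟨Or.inl h1, Or.inr (by linarith)⟩
    · have h2 : y e = 0 := by_contra fun h2 => notMem_positivePart horth (hxe e h1) (hye e h2)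
      exact ⟨Or.inr (by linarith), Or.inl h2⟩
  have aux : ∀ (e : E) (r : ℝ), (r = 0 ∨ r = ((O e : ℤ) : ℝ) - ((O' e : ℤ) : ℝ)) →
      0 ≤ r * ((O e : ℤ) : ℝ) ∧ 0 ≤ -r * ((O' e : ℤ) : ℝ) := by
    rintro e r (rfl | rfl)
    · simp
    · rcases cast_unit_eq O e with h1 | h1 <;> rcases cast_unit_eq O' e with h2 | h2 <;>
        rw [h1, h2] <;> norm_num
  exact ⟨x, hx, y, hy, fun e => (aux e _ (key e).1).1, fun e => (aux e _ (key e).1).2,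
    fun e => (aux e _ (key e).2).1, fun e => (aux e _ (key e).2).2, hxy⟩

/-- An orientation respecting both signatures is determined by its class. -/
theorem SplitEquiv.eq {M N : Matroid E} {L L' : Set (E → ℤ)} {σ : Signature L (circuits M)}
    {σ' : Signature L' (circuits N)} (hM : M.E = Set.univ) (hN : N.E = Set.univ)
    (horth : ∀ x ∈ V, ∀ y ∈ W, x ⬝ᵥ y = 0)
    (hL : ∀ α ∈ L, toReal α ∈ V) (hV : ∀ z ∈ V, M.Indep (Function.support z) → z = 0)
    (hL' : ∀ α ∈ L', toReal α ∈ W) (hW : ∀ z ∈ W, N.Indep (Function.support z) → z = 0)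
    (hσ : σ.IsAcyclic) (hσ' : σ'.IsAcyclic) (h : SplitEquiv V W O O')
    (h1 : σ.Respects O) (h1' : σ'.Respects O) (h2 : σ.Respects O') (h2' : σ'.Respects O') :
    O = O' := by
  obtain ⟨x, hx, y, hy, hx1, hx2, hy1, hy2, hxy⟩ := h.exists_conformal horth
  have hx0 : x = 0 := hσ.cone_pointed (h1.mem_cone hM hL hV hx hx1)
    (h2.mem_cone hM hL hV (V.neg_mem hx) hx2)
  have hy0 : y = 0 := hσ'.cone_pointed (h1'.mem_cone hN hL' hW hy hy1)
    (h2'.mem_cone hN hL' hW (W.neg_mem hy) hy2)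
  ext e
  have := hxy e
  simp only [hx0, hy0, Pi.zero_apply, add_zero, sub_eq_zero, Int.cast_inj] at this
  exact this

end Reversal

theorem exists_pos_forall_le [Fintype E] (f : E → ℝ) : ∃ t : ℝ, 0 < t ∧ ∀ e, 0 < f e → t ≤ f e := by
  classical
  by_cases h : (Finset.univ.filter fun e => 0 < f e).Nonempty
  · obtain ⟨e₀, he₀, hmin⟩ := Finset.exists_min_image _ f h
    simp only [Finset.mem_filter, Finset.mem_univ, true_and] at he₀ hmin
    exact ⟨f e₀, he₀, hmin⟩
  · simp only [Finset.not_nonempty_iff_eq_empty, Finset.filter_eq_empty_iff] at h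
    exact ⟨1, one_pos, fun e he => absurd he (h (Finset.mem_univ e))⟩

/-! ### Bases and orientations, with `N` in the role of the dual of `M` -/

section DualPair

variable [Fintype E] {M N : Matroid E} {L L' : Set (E → ℤ)} {σ : Signature L (circuits M)}
  {σ' : Signature L' (circuits N)} {O : Orientation E} {V W : Submodule ℝ (E → ℝ)}

theorem dotProduct_toFun_eq_single {B : Set E} {u : E → ℝ} (hu : ∀ e ∉ B, u e = 0)
    {D : circuits N} {e : E} (hD : (D : Set E) ⊆ insert e Bᶜ) :
    u ⬝ᵥ toReal (σ'.toFun D) = u e * (σ'.toFun D e : ℝ) := by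
  refine Finset.sum_eq_single e (fun f _ hf => ?_) fun h => absurd (Finset.mem_univ e) h
  by_cases hfB : f ∈ B
  · have : σ'.toFun D f = 0 := by
      by_contra hne
      rcases hD ((σ'.toFun_ne_zero_iff D f).1 hne) with h | h
      · exact hf h
      · exact h hfB
    simp [this]
  · simp [hu f hfB]

/-- A vector orthogonal to the signed cocircuits has dependent support, unless it is zero. -/
theorem eq_zero_of_indep_support (horth : ∀ x ∈ V, ∀ y ∈ W, x ⬝ᵥ y = 0)
    (hL' : ∀ α ∈ L', toReal α ∈ W)
    (hfund : ∀ B, M.IsBase B → ∀ e ∈ B, ∃ D : circuits N, e ∈ (D : Set E) ∧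
      (D : Set E) ⊆ insert e Bᶜ) (σ' : Signature L' (circuits N)) (z : E → ℝ) (hz : z ∈ V)
    (hI : M.Indep (Function.support z)) : z = 0 := by
  obtain ⟨B, hB, hzB⟩ := hI.exists_isBase_superset
  have hz0 : ∀ e ∉ B, z e = 0 := fun e he => by_contra fun h => he (hzB h)
  ext e
  by_cases he : e ∈ B
  · obtain ⟨D, heD, hD⟩ := hfund B hB e he
    have h := dotProduct_toFun_eq_single (σ' := σ') hz0 hD
    rw [horth z hz _ (hL' _ (σ'.mem_signedSets D).1)] at h
    have hne := (σ'.toFun_ne_zero_iff D e).2 heD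
    simpa [hne] using h.symm
  · exact hz0 e he

/-- A functional positive on both acyclic signatures. -/
theorem exists_dotProduct_pos (horth : ∀ x ∈ V, ∀ y ∈ W, x ⬝ᵥ y = 0)
    (hL : ∀ α ∈ L, toReal α ∈ V) (hL' : ∀ α ∈ L', toReal α ∈ W) (hσ : σ.IsAcyclic)
    (hσ' : σ'.IsAcyclic) : ∃ w : E → ℝ, (∀ C, 0 < w ⬝ᵥ toReal (σ.toFun C)) ∧
      ∀ D, 0 < w ⬝ᵥ toReal (σ'.toFun D) := by
  classical
  obtain ⟨w, hw⟩ := exists_forall_dotProduct_pos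
    (Sum.elim (fun C => toReal (σ.toFun C)) fun D => toReal (σ'.toFun D)) (by
      intro a ha hsum
      rw [Fintype.sum_sum_type] at hsum
      simp only [Sum.elim_inl, Sum.elim_inr] at hsum
      set x := ∑ C, a (Sum.inl C) • toReal (σ.toFun C) with hx
      set y := ∑ D, a (Sum.inr D) • toReal (σ'.toFun D) with hy
      have hxV : x ∈ V := V.sum_mem fun C _ => V.smul_mem _ (hL _ (σ.mem_signedSets C).1)
      have hyW : y ∈ W := W.sum_mem fun D _ => W.smul_mem _ (hL' _ (σ'.mem_signedSets D).1)
      -- A mixed relation gives `x = -y` in two orthogonal spaces, so it splits into one relation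
      -- for each signature.
      have hx0 : x = 0 := by
        rw [← dotProduct_self_eq_zero]
        have : x = -y := eq_neg_of_add_eq_zero_left hsum
        nth_rewrite 2 [this]
        rw [dotProduct_neg, horth x hxV y hyW, neg_zero]
      have hy0 : y = 0 := by simpa [hx0] using hsum
      rintro (C | D)
      · exact hσ.eq_zero_of_sum (a := fun C => a (Sum.inl C)) (fun C => ha _) hx0 C
      · exact hσ'.eq_zero_of_sum (a := fun D => a (Sum.inr D)) (fun D => ha _) hy0 D)
  exact ⟨w, fun C => hw (Sum.inl C), fun D => hw (Sum.inr D)⟩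

/-- Modulo `V`, `w` becomes a vector `u` supported on `B`. Pairing `u` with the fundamental
cocircuit of `e` isolates `u e`, and the pairing is positive because it equals that of `w`. -/
theorem MatchesFundCircuits.exists_base_vector {B : Set E} (h : MatchesFundCircuits σ B O)
    (h' : MatchesFundCircuits σ' Bᶜ O) (horth : ∀ x ∈ V, ∀ y ∈ W, x ⬝ᵥ y = 0)
    (hL : ∀ α ∈ L, toReal α ∈ V) (hL' : ∀ α ∈ L', toReal α ∈ W) {w : E → ℝ}
    (hw : ∀ D, 0 < w ⬝ᵥ toReal (σ'.toFun D)) :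
    ∃ u, w - u ∈ V ∧ (∀ e ∉ B, u e = 0) ∧ ∀ e ∈ B, 0 < u e * ((O e : ℤ) : ℝ) := by
  obtain ⟨u, hu, hu0, -⟩ := h.exists_cone_sub hL w
  refine ⟨u, hu, hu0, fun e he => ?_⟩
  obtain ⟨D, hD, hDe⟩ := h' e (by simpa using he)
  have h1 := horth _ hu _ (hL' _ (σ'.mem_signedSets D).1)
  have h2 := hw D
  rw [sub_dotProduct, sub_eq_zero] at h1
  rw [h1, dotProduct_toFun_eq_single hu0 hD, hDe] at h2
  exact h2

/-- A base is determined by an orientation matching its fundamental circuits and cocircuits. -/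
theorem base_eq_of_matches {B₁ B₂ : Set E} (hB₁ : M.Indep B₁) (hB₂ : M.Indep B₂)
    (horth : ∀ x ∈ V, ∀ y ∈ W, x ⬝ᵥ y = 0)
    (hL : ∀ α ∈ L, toReal α ∈ V) (hL' : ∀ α ∈ L', toReal α ∈ W)
    (hV : ∀ z ∈ V, M.Indep (Function.support z) → z = 0)
    (hσ : σ.IsAcyclic) (hσ' : σ'.IsAcyclic)
    (h₁ : MatchesFundCircuits σ B₁ O) (h₁' : MatchesFundCircuits σ' B₁ᶜ O)
    (h₂ : MatchesFundCircuits σ B₂ O) (h₂' : MatchesFundCircuits σ' B₂ᶜ O) : B₁ = B₂ := by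
  obtain ⟨w, -, hw⟩ := exists_dotProduct_pos horth hL hL' hσ hσ'
  obtain ⟨u₁, hu₁, h0₁, hp₁⟩ := h₁.exists_base_vector h₁' horth hL hL' hw
  obtain ⟨u₂, hu₂, h0₂, hp₂⟩ := h₂.exists_base_vector h₂' horth hL hL' hw
  have hz : u₁ - u₂ ∈ V := by
    have := V.sub_mem hu₂ hu₁
    rwa [sub_sub_sub_cancel_left] at this
  have hnn₁ : ∀ e, 0 ≤ u₁ e * ((O e : ℤ) : ℝ) := fun e => by
    by_cases he : e ∈ B₁
    · exact (hp₁ e he).le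
    · simp [h0₁ e he]
  have hnn₂ : ∀ e, 0 ≤ u₂ e * ((O e : ℤ) : ℝ) := fun e => by
    by_cases he : e ∈ B₂
    · exact (hp₂ e he).le
    · simp [h0₂ e he]
  -- Off `B₂` the difference is `u₁`, which is conformal to `O`; symmetrically, off `B₁` its
  -- negative is `u₂`.
  have hc₁ : u₁ - u₂ ∈ σ.cone := h₂.mem_cone hB₂ hL hV hz fun e he => by
    simpa [h0₂ e he] using hnn₁ e
  have hc₂ : -(u₁ - u₂) ∈ σ.cone := h₁.mem_cone hB₁ hL hV (V.neg_mem hz) fun e he => by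
    simpa [h0₁ e he] using hnn₂ e
  have heq : u₁ = u₂ := sub_eq_zero.1 (hσ.cone_pointed hc₁ hc₂)
  ext e
  constructor
  · intro he
    by_contra hne
    have := hp₁ e he
    simp [heq, h0₂ e hne] at this
  · intro he
    by_contra hne
    have := hp₂ e he
    simp [← heq, h0₁ e hne] at this

/-- A vector in the open orthant of `O` that is positive on the second signature. -/
theorem Signature.Respects.exists_pos (hN : N.E = Set.univ) (h' : σ'.Respects O)
    (hL' : ∀ α ∈ L', toReal α ∈ W) (hW : ∀ z ∈ W, N.Indep (Function.support z) → z = 0)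
    (hσ' : σ'.IsAcyclic) :
    ∃ d : E → ℝ, Conformal O d ∧ ∀ D, 0 < d ⬝ᵥ toReal (σ'.toFun D) := by
  classical
  -- The added vectors `O e` at coordinate `e` force `w` into the open orthant. In a nonnegative
  -- relation the signature part `y` has `-y` conformal to `O`, so both `y` and `-y` lie in the
  -- cone.
  obtain ⟨w, hw⟩ := exists_forall_dotProduct_pos
    (Sum.elim (fun D => toReal (σ'.toFun D))
      fun e : E => Pi.single e ((O e : ℤ) : ℝ)) (by
      intro a ha hsum
      rw [Fintype.sum_sum_type] at hsum
      simp only [Sum.elim_inl, Sum.elim_inr] at hsum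
      set y := ∑ D, a (Sum.inl D) • toReal (σ'.toFun D) with hy
      have hs : ∀ f, (∑ e, a (Sum.inr e) • (Pi.single e ((O e : ℤ) : ℝ) : E → ℝ)) f =
          a (Sum.inr f) * ((O f : ℤ) : ℝ) := by
        intro f
        rw [Finset.sum_apply, Finset.sum_eq_single f] <;> simp +contextual [eq_comm]
      have hyW : y ∈ W := W.sum_mem fun D _ => W.smul_mem _ (hL' _ (σ'.mem_signedSets D).1)
      have hyneg : ∀ f, -y f = a (Sum.inr f) * ((O f : ℤ) : ℝ) := by
        intro f
        have := congrFun hsum f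
        rw [Pi.add_apply, hs] at this
        simp only [Pi.zero_apply] at this
        linarith
      have hconf : Conformal O (-y) := by
        intro f
        rw [Pi.neg_apply, hyneg, mul_assoc, cast_unit_mul_self, mul_one]
        exact ha _
      have hycone : y ∈ σ'.cone := σ'.mem_cone_iff.2 ⟨_, fun D => ha _, hy.symm⟩
      have hy0 : y = 0 :=
        hσ'.cone_pointed hycone (h'.mem_cone hN hL' hW (W.neg_mem hyW) hconf)
      rintro (D | f)
      · exact hσ'.eq_zero_of_sum (a := fun D => a (Sum.inl D)) (fun D => ha _) hy0 D
      · have := hyneg f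
        rw [hy0] at this
        rcases cast_unit_eq O f with h1 | h1 <;> simpa [h1] using this.symm)
  refine ⟨w, fun e => ?_, fun D => hw (Sum.inl D)⟩
  simpa using (hw (Sum.inr e)).le

/-- Every orientation respecting both signatures comes from a base, found by minimising a linear
functional over a polyhedron. -/
theorem exists_base_of_respects (hM : M.E = Set.univ) (hN : N.E = Set.univ)
    (horth : ∀ x ∈ V, ∀ y ∈ W, x ⬝ᵥ y = 0)
    (hL : ∀ α ∈ L, toReal α ∈ V) (hL' : ∀ α ∈ L', toReal α ∈ W)
    (hV : ∀ z ∈ V, M.Indep (Function.support z) → z = 0)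
    (hW : ∀ z ∈ W, N.Indep (Function.support z) → z = 0)
    (hfund : ∀ B, M.IsBase B → ∀ e ∈ B, ∃ D : circuits N, e ∈ (D : Set E) ∧
      (D : Set E) ⊆ insert e Bᶜ)
    (hσ : σ.IsAcyclic) (hσ' : σ'.IsAcyclic) (h : σ.Respects O) (h' : σ'.Respects O) :
    ∃ B, M.IsBase B ∧
      (∀ e ∉ B, ∀ C : circuits M, e ∈ (C : Set E) → (C : Set E) ⊆ insert e B →
        σ.toFun C e = (O e : ℤ)) ∧
      (∀ e ∈ B, ∀ D : circuits N, e ∈ (D : Set E) → (D : Set E) ⊆ insert e Bᶜ →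
        σ'.toFun D e = (O e : ℤ)) := by
  obtain ⟨w, hw, -⟩ := exists_dotProduct_pos horth hL hL' hσ hσ'
  obtain ⟨d₀, hd₀, hd₀pos⟩ := h'.exists_pos hN hL' hW hσ'
  set S : Set (E → ℝ) := {d | d - d₀ ∈ V ∧ Conformal O d ∧ M.Indep (Function.support d)} with hS
  have hreduce : ∀ d, d - d₀ ∈ V → Conformal O d → ∃ d' ∈ S, w ⬝ᵥ d' ≤ w ⬝ᵥ d := by
    intro d hd hdO
    obtain ⟨d', h1, h2, h3⟩ := h.exists_indep_support hM d hdO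
    refine ⟨d', ⟨?_, h1, h2⟩, ?_⟩
    · have := V.sub_mem hd (σ.cone_le_restrictScalars hL h3)
      have heq : d - d₀ - (d - d') = d' - d₀ := by abel
      rwa [heq] at this
    · have := σ.dotProduct_nonneg_of_mem_cone hw h3
      rw [dotProduct_sub] at this
      linarith
  -- Points of `S` are determined by their supports: two with the same support differ by a vector of
  -- `V` with independent support.
  have hSfin : S.Finite := by
    refine Set.Finite.of_finite_image (f := Function.support) (Set.toFinite _) ?_
    rintro d₁ ⟨h1, -, hI⟩ d₂ ⟨h2, -, -⟩ heq
    have hmem : d₁ - d₂ ∈ V := by simpa using V.sub_mem h1 h2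
    refine sub_eq_zero.1 (hV _ hmem (hI.subset fun e he => ?_))
    by_contra hne
    have hne2 : e ∉ Function.support d₂ := heq ▸ hne
    simp only [Function.mem_support, not_not] at hne hne2
    simp [hne, hne2] at he
  obtain ⟨d₁, hd₁, -⟩ := hreduce d₀ (by simp) hd₀
  obtain ⟨d, ⟨hdV, hdO, hdI⟩, hmin⟩ := Set.exists_min_image S (fun d => w ⬝ᵥ d) hSfin ⟨d₁, hd₁⟩
  -- Positivity carries over from `d₀` because `d - d₀` is orthogonal to `W`. It makes `d` nonzero
  -- on all of a base containing its support.
  have hdpos : ∀ D, 0 < d ⬝ᵥ toReal (σ'.toFun D) := by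
    intro D
    have := horth _ hdV _ (hL' _ (σ'.mem_signedSets D).1)
    rw [sub_dotProduct, sub_eq_zero] at this
    exact this ▸ hd₀pos D
  obtain ⟨B, hB, hdB⟩ := hdI.exists_isBase_superset
  have hd0 : ∀ e ∉ B, d e = 0 := fun e he => by_contra fun h => he (hdB h)
  have hsign : ∀ e ∈ B, ∀ D : circuits N, (D : Set E) ⊆ insert e Bᶜ →
      0 < d e * (σ'.toFun D e : ℝ) := fun e he D hD =>
    dotProduct_toFun_eq_single (σ' := σ') hd0 hD ▸ hdpos D
  have hdB' : ∀ e ∈ B, 0 < d e * ((O e : ℤ) : ℝ) := by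
    intro e he
    obtain ⟨D, -, hD⟩ := hfund B hB e he
    refine lt_of_le_of_ne (hdO e) (Ne.symm (mul_ne_zero ?_ ?_))
    · exact left_ne_zero_of_mul (hsign e he D hD).ne'
    · rcases cast_unit_eq O e with h | h <;> simp [h]
  refine ⟨B, hB, fun e he C heC hC => ?_, fun e he D heD hD => ?_⟩
  · by_contra hne
    -- If `C` had the wrong sign at `e`, subtracting `t` times it would stay in the orthant: `t` is
    -- small enough on `B`, and at `e` the move goes from 0 towards `O e`. This would lower `w`,
    -- against minimality.
    obtain ⟨t, ht, hle⟩ := exists_pos_forall_le fun e => d e * ((O e : ℤ) : ℝ)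
    obtain ⟨d', hd'S, hd'⟩ := hreduce (d - t • toReal (σ.toFun C)) (by
        rw [sub_right_comm]
        exact V.sub_mem hdV (V.smul_mem _ (hL _ (σ.mem_signedSets C).1))) (by
        intro f
        simp only [Pi.sub_apply, Pi.smul_apply, smul_eq_mul, toReal_apply]
        by_cases hf : f ∈ B
        · have h1 := hle f (hdB' f hf)
          rcases σ.toFun_eq C f with h2 | h2 | h2 <;> rcases cast_unit_eq O f with h3 | h3 <;>
            rw [h3] at h1 ⊢ <;> simp only [h2] <;> push_cast <;> linarith
        · rw [hd0 f hf]
          by_cases hfe : f = e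
          · subst hfe
            have h2 := (σ.toFun_ne_zero_iff C f).2 heC
            rcases σ.toFun_eq C f with h3 | h3 | h3 <;>
              rcases Int.units_eq_one_or (O f) with h4 | h4 <;> simp_all [ht.le]
          · have : σ.toFun C f = 0 := by
              by_contra hne
              rcases hC ((σ.toFun_ne_zero_iff C f).1 hne) with h | h
              · exact hfe h
              · exact hf h
            simp [this])
    have h1 := hmin d' hd'S
    have h2 := mul_pos ht (hw C)
    rw [dotProduct_sub, dotProduct_smul, smul_eq_mul] at hd'
    linarith
  · have h1 := hsign e he D hD
    have h2 := hdB' e he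
    rcases σ'.toFun_eq D e with h3 | h3 | h3 <;>
      rcases Int.units_eq_one_or (O e) with h4 | h4 <;> simp [h3, h4] at h1 h2 ⊢ <;> linarith

end DualPair

end DualPairs

/-! ### Kernel and row space of the matrix, and the bijection -/

section Realisation

variable {R E : Type*}

/-- The real kernel of `A`. -/
def realKernel [Fintype E] (A : Matrix R E ℤ) : Submodule ℝ (E → ℝ) :=
  LinearMap.ker (A.map (Int.cast : ℤ → ℝ)).mulVecLin

/-- The real row space of `A`. -/
def realRowSpace [Fintype R] (A : Matrix R E ℤ) : Submodule ℝ (E → ℝ) :=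
  LinearMap.range (A.map (Int.cast : ℤ → ℝ)).vecMulLinear

theorem toReal_mem_realKernel [Fintype E] {A : Matrix R E ℤ} :
    ∀ α ∈ circuitLattice A, toReal α ∈ realKernel A := by
  intro α hα
  have hα' : A *ᵥ α = 0 := hα
  show A.map (Int.cast : ℤ → ℝ) *ᵥ toReal α = 0
  ext i
  have := congrArg (Int.cast : ℤ → ℝ) (congrFun hα' i)
  simpa [Matrix.mulVec, dotProduct] using this

theorem toReal_mem_realRowSpace [Fintype R] {A : Matrix R E ℤ} :
    ∀ α ∈ cocircuitLattice A, toReal α ∈ realRowSpace A := by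
  rintro α ⟨y, hy⟩
  refine ⟨fun i => (y i : ℝ), ?_⟩
  ext e
  have := congrArg (Rat.cast : ℚ → ℝ) (congrFun hy e)
  simpa [Matrix.vecMul, dotProduct] using this

variable {A : Matrix R E ℤ} {M : Matroid E}

theorem signedCircuits_neg_mem [Fintype E] (σ : CircuitSignature A M) (C : circuits M) :
    -σ.toFun C ∈ signedCircuits A M := by
  obtain ⟨h1, h2, h3, h4⟩ := σ.mem_signedSets C
  refine ⟨?_, neg_ne_zero.2 h2, fun e => ?_, ?_⟩
  · have h1' : A *ᵥ σ.toFun C = 0 := h1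
    show A *ᵥ (-σ.toFun C) = 0
    rw [Matrix.mulVec_neg, h1', neg_zero]
  · rcases h3 e with h | h | h <;> simp [h]
  · rwa [Function.support_neg]

theorem signedCocircuits_neg_mem [Fintype R] (σ' : CocircuitSignature A M) (D : cocircuits M) :
    -σ'.toFun D ∈ signedCocircuits A M := by
  obtain ⟨⟨y, hy⟩, h2, h3, h4⟩ := σ'.mem_signedSets D
  refine ⟨⟨-y, ?_⟩, neg_ne_zero.2 h2, fun e => ?_, ?_⟩
  · rw [Matrix.neg_vecMul, hy]
    ext e
    simp
  · rcases h3 e with h | h | h <;> simp [h]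
  · rwa [Function.support_neg]

theorem fundCocircuit_subset_insert (hE : M.E = Set.univ) (e : E) (B : Set E) :
    M.fundCocircuit e B ⊆ insert e Bᶜ := by
  have := M.fundCocircuit_subset_insert_compl e B
  rwa [hE, ← Set.compl_eq_univ_sdiff] at this

theorem exists_fundCocircuit (hE : M.E = Set.univ) (B : Set E) (hB : M.IsBase B) (e : E)
    (he : e ∈ B) : ∃ D : circuits M✶, e ∈ (D : Set E) ∧ (D : Set E) ⊆ insert e Bᶜ :=
  ⟨⟨M.fundCocircuit e B, fundCocircuit_mem_cocircuits hB he⟩, M.mem_fundCocircuit e B,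
    fundCocircuit_subset_insert hE e B⟩

theorem exists_fundCircuit_dual (hE : M.E = Set.univ) (B : Set E) (hB : M✶.IsBase B) (e : E)
    (he : e ∈ B) : ∃ D : circuits M, e ∈ (D : Set E) ∧ (D : Set E) ⊆ insert e Bᶜ := by
  have hB' : M.IsBase Bᶜ := by
    have := hB.compl_isBase_of_dual
    rwa [hE, ← Set.compl_eq_univ_sdiff] at this
  exact ⟨⟨M.fundCircuit e Bᶜ, hB'.fundCircuit_isCircuit (hE ▸ Set.mem_univ e) (by simpa using he)⟩,
    M.mem_fundCircuit e _, M.fundCircuit_subset_insert e _⟩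

variable [Fintype R] [Fintype E]

theorem dotProduct_eq_zero_of_mem (A : Matrix R E ℤ) :
    ∀ x ∈ realKernel A, ∀ y ∈ realRowSpace A, x ⬝ᵥ y = 0 := by
  rintro x hx _ ⟨y, rfl⟩
  have hx' : A.map (Int.cast : ℤ → ℝ) *ᵥ x = 0 := hx
  rw [Matrix.vecMulLinear_apply, dotProduct_comm, ← Matrix.dotProduct_mulVec, hx',
    dotProduct_zero]

theorem splitEquiv_of_eqvGen {O O' : Orientation E}
    (h : Relation.EqvGen (Reversal A M) O O') :
    SplitEquiv (realKernel A) (realRowSpace A) O O' := by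
  have horth := dotProduct_eq_zero_of_mem A
  induction h with
  | rel O O' h =>
    obtain ⟨α, hα | hα, hc, rfl⟩ := h
    · exact hc.splitEquiv horth (toReal_mem_realKernel α hα.1)
    -- A cocircuit reversal is the circuit case with kernel and row space exchanged.
    · exact (hc.splitEquiv (fun x hx y hy => dotProduct_comm x y ▸ horth y hy x hx)
        (toReal_mem_realRowSpace α hα.1)).swap
  | refl O => exact SplitEquiv.refl O
  | symm _ _ _ ih => exact ih.symm
  | trans _ _ _ _ _ ih1 ih2 => exact ih1.trans ih2

/-- Reversing `-α` adds `2α` to the orientation vector. -/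
theorem Compatible.dotProduct_reverse_lt {O : Orientation E} {α : E → ℤ}
    (h : Compatible O (-α)) {w : E → ℝ} (hw : 0 < w ⬝ᵥ toReal α) :
    w ⬝ᵥ toReal (fun e => (O e : ℤ)) < w ⬝ᵥ toReal (fun e => (reverse O (-α) e : ℤ)) := by
  have heq : toReal (fun e => (O e : ℤ)) - toReal (fun e => (reverse O (-α) e : ℤ)) =
      (-2 : ℝ) • toReal α := by
    ext e
    have := h.sub_reverse e
    simp only [Pi.sub_apply, toReal_apply, Pi.smul_apply, smul_eq_mul]
    rw [this, Pi.neg_apply]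
    push_cast
    ring
  have := congrArg (w ⬝ᵥ ·) heq
  simp only [dotProduct_sub, dotProduct_smul, smul_eq_mul] at this
  linarith

/-- Every reversal class contains an orientation respecting both signatures. -/
theorem exists_respects (σ : CircuitSignature A M) (hσ : σ.IsAcyclic)
    (σ' : CocircuitSignature A M) (hσ' : σ'.IsAcyclic) (O : Orientation E) :
    ∃ O', Relation.EqvGen (Reversal A M) O O' ∧ σ.Respects O' ∧ σ'.Respects O' := by
  obtain ⟨w, hw, hw'⟩ := exists_dotProduct_pos (M := M) (N := M✶) (dotProduct_eq_zero_of_mem A)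
    toReal_mem_realKernel toReal_mem_realRowSpace hσ hσ'
  obtain ⟨O', hO', hmax⟩ := Set.exists_max_image {O' | Relation.EqvGen (Reversal A M) O O'}
    (fun O' => w ⬝ᵥ toReal fun e => (O' e : ℤ)) (Set.toFinite _) ⟨O, .refl O⟩
  refine ⟨O', hO', fun C hC => ?_, fun D hD => ?_⟩
  · refine (hmax (reverse O' (-σ.toFun C)) (.trans _ _ _ hO' (.rel _ _ ?_))).not_gt
      (hC.dotProduct_reverse_lt (hw C))
    exact ⟨_, Or.inl (signedCircuits_neg_mem σ C), hC, rfl⟩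
  · refine (hmax (reverse O' (-σ'.toFun D)) (.trans _ _ _ hO' (.rel _ _ ?_))).not_gt
      (hD.dotProduct_reverse_lt (hw' D))
    exact ⟨_, Or.inr (signedCocircuits_neg_mem σ' D), hD, rfl⟩

section BasisOrientation

variable (hA : Represents A M) (σ : CircuitSignature A M) (σ' : CocircuitSignature A M)
  (B : {B : Set E // M.IsBase B})

theorem basisOrientation_of_notMem {e : E} (he : e ∉ (B : Set E)) :
    (basisOrientation hA σ σ' B e : ℤ) =
      σ.toFun ⟨M.fundCircuit e B, fundCircuit_mem_circuits hA B.2 he⟩ e := by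
  rw [basisOrientation, dif_neg he, IsUnit.unit_spec]

theorem basisOrientation_of_mem {e : E} (he : e ∈ (B : Set E)) :
    (basisOrientation hA σ σ' B e : ℤ) =
      σ'.toFun ⟨M.fundCocircuit e B, fundCocircuit_mem_cocircuits B.2 he⟩ e := by
  rw [basisOrientation, dif_pos he, IsUnit.unit_spec]

theorem basisOrientation_matches :
    MatchesFundCircuits σ (B : Set E) (basisOrientation hA σ σ' B) := fun e he =>
  ⟨_, M.fundCircuit_subset_insert e B, (basisOrientation_of_notMem hA σ σ' B he).symm⟩

theorem basisOrientation_matches_dual :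
    MatchesFundCircuits (N := M✶) σ' (B : Set E)ᶜ (basisOrientation hA σ σ' B) := fun e he =>
  ⟨_, fundCocircuit_subset_insert hA.ground_eq e B,
    (basisOrientation_of_mem hA σ σ' B (Set.notMem_compl_iff.1 he)).symm⟩

end BasisOrientation

theorem bijective_basisOrientation (hA : Represents A M)
    (σ : CircuitSignature A M) (hσ : σ.IsAcyclic)
    (σ' : CocircuitSignature A M) (hσ' : σ'.IsAcyclic) :
    Function.Bijective (fun B : {B : Set E // M.IsBase B} =>
      (Quotient.mk (reversalSetoid A M) (basisOrientation hA σ σ' B) : ReversalClasses A M)) := by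
  have hE := hA.ground_eq
  have hE' : M✶.E = Set.univ := hE
  have horth := dotProduct_eq_zero_of_mem A
  have horth' : ∀ x ∈ realRowSpace A, ∀ y ∈ realKernel A, x ⬝ᵥ y = 0 :=
    fun x hx y hy => dotProduct_comm x y ▸ horth y hy x hx
  have hL := toReal_mem_realKernel (A := A)
  have hL' := toReal_mem_realRowSpace (A := A)
  have hV := eq_zero_of_indep_support (M := M) (N := M✶) horth hL' (exists_fundCocircuit hE) σ'
  have hW := eq_zero_of_indep_support (M := M✶) (N := M) horth' hL (exists_fundCircuit_dual hE) σ
  have hm := basisOrientation_matches hA σ σ'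
  have hm' := basisOrientation_matches_dual hA σ σ'
  have hres : ∀ B, σ.Respects (basisOrientation hA σ σ' B) := fun B =>
    (hm B).respects hσ B.2.indep hL hV
  have hres' : ∀ B, σ'.Respects (basisOrientation hA σ σ' B) := fun B => by
    have hB := B.2.compl_isBase_dual.indep
    rw [hE, ← Set.compl_eq_univ_sdiff] at hB
    exact (hm' B).respects hσ' hB hL' hW
  constructor
  · intro B₁ B₂ h
    have heq := (splitEquiv_of_eqvGen (Quotient.exact h)).eq (N := M✶) hE hE' horth hL hV hL' hW
      hσ hσ' (hres B₁) (hres' B₁) (hres B₂) (hres' B₂)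
    exact Subtype.ext (base_eq_of_matches (N := M✶) B₁.2.indep B₂.2.indep horth hL hL' hV hσ hσ'
      (hm B₁) (hm' B₁) (heq ▸ hm B₂) (heq ▸ hm' B₂))
  · intro q
    obtain ⟨O, rfl⟩ := Quotient.exists_rep q
    obtain ⟨O', hO, h1, h2⟩ := exists_respects σ hσ σ' hσ' O
    obtain ⟨B, hB, hout, hin⟩ := exists_base_of_respects (N := M✶) hE hE' horth hL hL' hV hW
      (exists_fundCocircuit hE) hσ hσ' h1 h2
    refine ⟨⟨B, hB⟩, ?_⟩
    have heq : basisOrientation hA σ σ' ⟨B, hB⟩ = O' := by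
      ext e
      by_cases he : e ∈ B
      · rw [basisOrientation_of_mem hA σ σ' ⟨B, hB⟩ he]
        exact hin e he _ (M.mem_fundCocircuit e B) (fundCocircuit_subset_insert hE e B)
      · rw [basisOrientation_of_notMem hA σ σ' ⟨B, hB⟩ he]
        exact hout e he _ (M.mem_fundCircuit e B) (M.fundCircuit_subset_insert e B)
    simp only [heq]
    exact Quotient.sound (.symm _ _ hO)

end Realisation

end RegularMatroid

theorem theorem1p3 {R E : Type*} [Fintype R] [Fintype E] (M : Matroid E) (A : Matrix R E ℤ)
    (hA : RegularMatroid.Represents A M)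
    (σ : RegularMatroid.CircuitSignature A M) (hσ : σ.IsAcyclic)
    (σ' : RegularMatroid.CocircuitSignature A M) (hσ' : σ'.IsAcyclic) :
    Function.Bijective
      (fun B : {B : Set E // M.IsBase B} =>
        (Quotient.mk (RegularMatroid.reversalSetoid A M)
          (RegularMatroid.basisOrientation hA σ σ' B) :
          RegularMatroid.ReversalClasses A M)) := by
  exact RegularMatroid.bijective_basisOrientation hA σ hσ σ' hσ'
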